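/- Let $X$ be a finite connected CW complex of dimension $d\ge 1$, with set $X_k$ of $k$-cells. For a commutative ring $R$ let $C_k(X;R)$ be the cellular chain group, the free $R$-module on $X_k$ (the cells being oriented), with boundary operator $\partial$, let $B_k(X;R)\subseteq C_k(X;R)$ be the submodule of boundaries, and give $C_k(X;\mathbb R)$ the inner product for which $X_k$ is an orthonormal basis. Let $W: X_d\to\mathbb R$, let $e^{-W}: C_d(X;\mathbb R)\to C_d(X;\mathbb R)$ be the linear map with $b\mapsto e^{-W_b}b$ for $b\in X_d$, and let $\partial^*: C_{d-1}(X;\mathbb R)\to C_d(X;\mathbb R)$ be the adjoint of $\partial$. A spanning tree of $X$ is a subcomplex $T\subseteq X$ that contains the $(d-1)$-skeleton of $X$ and satisfies $H_d(T;\mathbb Z)=0$ and $\dim H_{d-1}(T;\mathbb R)=\dim H_{d-1}(X;\mathbb R)$. Let $\theta_T$ and $\theta_X$ denote the orders of the torsion subgroups of $H_{d-1}(T;\mathbb Z)$ and $H_{d-1}(X;\mathbb Z)$, and put $w_T=\theta_T^2\prod_{b\in T_d}e^{-W_b}$, where $T_d$ is the set of $d$-cells of $T$. A homomorphism $\alpha: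 M\to N$ of finitely generated abelian groups is a real isomorphism if $\alpha_{\mathbb R}=\alpha\otimes\mathbb R$ is an isomorphism; $t(\alpha)$ denotes the order of the torsion subgroup of $N/\alpha(M)$. Let $A\subseteq C_{d-1}(X;\mathbb Z)$ be a subgroup, let $A_{\mathbb R}\subseteq C_{d-1}(X;\mathbb R)$ be its real span, and let $\mu(A)=\det(\langle e_i,e_j\rangle)_{i,j}$ for any $\mathbb Z$-basis $(e_i)$ of $A$. Let $P_A: B_{d-1}(X;\mathbb R)\to A_{\mathbb R}$ be the restriction to $B_{d-1}(X;\mathbb R)$ of the orthogonal projection of $C_{d-1}(X;\mathbb R)$ onto $A_{\mathbb R}$, and suppose that $P_A=(p_A)_{\mathbb R}$ for a real isomorphism $p_A: B_{d-1}(X;\mathbb Z)\to A$. Then the operator $\mathcal L_A=P_A\,\partial e^{-W}\partial^*|_{A_{\mathbb R}}: A_{\mathbb R}\to A_{\mathbb R}$ satisfies $$\det\mathcal L_A=\gamma_A\sum_T w_T,\qquad \gamma_A=\frac{\mu(A)\,t(p_A)^2}{\theta_X^2},$$ where the sum runs over all spanning trees $T$ of $X$. -/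

import Mathlib

open CategoryTheory CategoryTheory.Limits Topology

noncomputable section

universe u

namespace MatrixTree

/-! ### Singular homology of pairs -/

/-- Singular chains with integer coefficients. -/
abbrev singularChains : TopCat.{u} ⥤ ChainComplex (ModuleCat.{u} ℤ) ℕ :=
  (AlgebraicTopology.singularChainComplexFunctor (ModuleCat.{u} ℤ)).obj
    (ModuleCat.of ℤ (ULift.{u} ℤ))

/-- The short complex `S(A) ⟶ S(X) ⟶ S(X) / S(A)` of a pair `(X, A)`. -/
abbrev pairShortComplex (P : TopPair.{u}) : ShortComplex (ChainComplex (ModuleCat.{u} ℤ) ℕ) :=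
  ShortComplex.mk (singularChains.map P.map) (cokernel.π (singularChains.map P.map))
    (cokernel.condition _)

theorem pairShortComplex_shortExact (P : TopPair.{u}) : (pairShortComplex P).ShortExact := by
  have : Mono P.map := (TopCat.mono_iff_injective _).2 P.isEmbedding_map.injective
  have : Mono (pairShortComplex P).f := by
    dsimp only [pairShortComplex]
    infer_instance
  have : Epi (pairShortComplex P).g := by
    dsimp only [pairShortComplex]
    infer_instance
  exact ⟨ShortComplex.exact_of_g_is_cokernel _ (cokernelIsCokernel _)⟩

/-- Relative singular homology `H_k(X, A; ℤ)`. -/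
def relHomology (P : TopPair.{u}) (k : ℕ) : ModuleCat.{u} ℤ :=
  (pairShortComplex P).X₃.homology k

/-- The map on relative singular homology induced by a map of pairs. -/
def relHomologyMap {P Q : TopPair.{u}} (f : P ⟶ Q) (k : ℕ) : relHomology P k ⟶ relHomology Q k :=
  HomologicalComplex.homologyMap
    (cokernel.map (singularChains.map P.map) (singularChains.map Q.map)
      (singularChains.map (TopPair.Hom.snd f)) (singularChains.map (TopPair.Hom.fst f))
      (by rw [← Functor.map_comp, ← Functor.map_comp, TopPair.Hom.w])) k

/-- The connecting homomorphism `H_{k+1}(X, A) ⟶ H_k(A)` of the long exact sequence of a pair. -/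
def connecting (P : TopPair.{u}) (k : ℕ) :
    relHomology P (k + 1) ⟶ (singularChains.obj P.snd).homology k :=
  (pairShortComplex_shortExact P).δ (k + 1) k rfl

/-- The map `H_k(X) ⟶ H_k(X, A)`. -/
def toRelHomology (P : TopPair.{u}) (k : ℕ) :
    (singularChains.obj P.fst).homology k ⟶ relHomology P k :=
  HomologicalComplex.homologyMap (pairShortComplex P).g k

/-! ### Cellular chains of a CW complex -/

/-- The pair `(D^k, ∂D^k)`; the disc is the unit ball of `Fin k → ℝ` with the maximum norm, as in
the definition of a CW complex. -/
abbrev discPair (k : ℕ) : TopPair.{u} :=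
  TopPair.of
    (A := TopCat.of (ULift.{u} (Metric.sphere (0 : Fin k → ℝ) 1)))
    (X := TopCat.of (ULift.{u} (Metric.closedBall (0 : Fin k → ℝ) 1)))
    (TopCat.ofHom
      { toFun := fun x => ULift.up (Set.inclusion Metric.sphere_subset_closedBall x.down)
        continuous_toFun := by
          exact continuous_uliftUp.comp
            ((continuous_inclusion Metric.sphere_subset_closedBall).comp continuous_uliftDown) })
    (Homeomorph.ulift.symm.isEmbedding.comp
      ((Topology.IsEmbedding.inclusion Metric.sphere_subset_closedBall).comp
        Homeomorph.ulift.isEmbedding))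

variable {X : Type u} [TopologicalSpace X] [T2Space X] (C : Set X) [CWComplex C]

/-- The space `X^(k-1)`, with `X^(-1) = ∅`: Mathlib's `skeletonLT C k` is the union of the cells
of dimension `< k`. -/
abbrev skeletonSpace (k : ℕ) : TopCat.{u} :=
  TopCat.of (CWComplex.skeletonLT C k : Set X)

/-- The pair `(X^(k), X^(k-1))`. -/
abbrev skeletonPair (k : ℕ) : TopPair.{u} :=
  TopPair.of (A := skeletonSpace C k) (X := skeletonSpace C (k + 1))
    (TopCat.ofHom
      { toFun := Set.inclusion (CWComplex.skeletonLT_mono (by exact_mod_cast Nat.le_succ k))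
        continuous_toFun := continuous_inclusion _ })
    (Topology.IsEmbedding.inclusion
      (CWComplex.skeletonLT_mono (by exact_mod_cast Nat.le_succ k)))

/-- The characteristic map `(D^k, ∂D^k) ⟶ (X^(k), X^(k-1))` of a `k`-cell. -/
def characteristicMap (k : ℕ) (e : RelCWComplex.cell C k) :
    discPair.{u} k ⟶ skeletonPair C k :=
  TopPair.ofHom (X := discPair.{u} k) (Y := skeletonPair C k)
    (TopCat.ofHom
      { toFun := fun x => ⟨RelCWComplex.map (C := C) k e x.down.1,
          CWComplex.closedCell_subset_skeletonLT k e (Set.mem_image_of_mem _ x.down.2)⟩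
        continuous_toFun := by
          refine Continuous.subtype_mk ?_ _
          exact (RelCWComplex.continuousOn (C := C) k e).comp_continuous
            (continuous_subtype_val.comp continuous_uliftDown) (fun x => x.down.2) })
    (TopCat.ofHom
      { toFun := fun x => ⟨RelCWComplex.map (C := C) k e x.down.1,
          CWComplex.cellFrontier_subset_skeletonLT k e (Set.mem_image_of_mem _ x.down.2)⟩
        continuous_toFun := by
          refine Continuous.subtype_mk ?_ _
          exact (RelCWComplex.continuousOn (C := C) k e).comp_continuous
            (continuous_subtype_val.comp continuous_uliftDown)
            (fun x => Metric.sphere_subset_closedBall x.down.2) })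
    (by ext x; rfl)

/-- The boundary `H_{k+1}(X^(k+1), X^(k)) ⟶ H_k(X^(k)) ⟶ H_k(X^(k), X^(k-1))` of the cellular
chain complex. -/
def singularCellularBoundary (k : ℕ) :
    relHomology (skeletonPair C (k + 1)) (k + 1) ⟶ relHomology (skeletonPair C k) k :=
  connecting (skeletonPair C (k + 1)) k ≫ toRelHomology (skeletonPair C k) k

/-- Orientations of the cells: for each `k`-cell a generator of the infinite cyclic group
`H_k(D^k, ∂D^k; ℤ)`. -/
structure Orientation where
  gen (k : ℕ) : RelCWComplex.cell C k → relHomology (discPair.{u} k) k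
  span_gen (k : ℕ) (e : RelCWComplex.cell C k) : Submodule.span ℤ {gen k e} = ⊤

/-- `X` as a subcomplex of itself. -/
def whole : CWComplex.Subcomplex C where
  carrier := C
  I := fun _ => Set.univ
  closed' := CWComplex.isClosed
  union' := by
    have h := CWComplex.iUnion_openCell_eq_complex (C := C)
    simpa using h

instance finite_subcomplex [CWComplex.Finite C] : Finite (CWComplex.Subcomplex C) := by
  have : Finite (Σ n, RelCWComplex.cell C n) := CWComplex.finite_iff_finite_cells.1 inferInstance
  refine Finite.of_injective
    (fun T : CWComplex.Subcomplex C => {e : Σ n, RelCWComplex.cell C n | e.2 ∈ T.I e.1}) ?_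
  intro S T h
  have hI : S.I = T.I := by
    funext n
    ext e
    exact Set.ext_iff.1 h ⟨n, e⟩
  refine SetLike.coe_injective ?_
  rw [← CWComplex.Subcomplex.union (E := S), ← CWComplex.Subcomplex.union (E := T), hI]

variable {C}

/-- `C_k(T; R) ⊆ C_k(X; R)`: the cellular chains of a subcomplex `T` are those supported on
the cells of `T`, with the restricted boundary. -/
def chains (T : CWComplex.Subcomplex C) (R : Type*) [CommRing R] (k : ℕ) :
    Submodule R (RelCWComplex.cell C k → R) where
  carrier := {x | ∀ e, e ∉ T.I k → x e = 0}
  add_mem' := fun hx hy e he => by simp [hx e he, hy e he]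
  zero_mem' := fun _ _ => rfl
  smul_mem' := fun c x hx e he => by simp [hx e he]

variable [∀ k, Fintype (RelCWComplex.cell C k)]

/-- The map `ℤ^{X_k} → H_k(X^(k), X^(k-1); ℤ)` that sends a cell to the image of its orientation
class under its characteristic map. It is an isomorphism for every CW complex, and identifies
`H_k(X^(k), X^(k-1); ℤ)` with the free abelian group on the set `X_k` of `k`-cells. -/
def cellsToChains (o : Orientation C) (k : ℕ) :
    (RelCWComplex.cell C k → ℤ) →ₗ[ℤ] relHomology (skeletonPair C k) k :=
  Fintype.linearCombination ℤ
    (fun e => (relHomologyMap (characteristicMap C k e) k).hom (o.gen k e))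

open scoped Classical in
/-- The cellular boundary `∂ : C_{k+1}(X; ℤ) → C_k(X; ℤ)` in the bases of cells, obtained by
transport along `cellsToChains` (which is always bijective, so the value `0` is never used). -/
def integralBoundary (o : Orientation C) (k : ℕ) :
    (RelCWComplex.cell C (k + 1) → ℤ) →ₗ[ℤ] (RelCWComplex.cell C k → ℤ) :=
  if h : Function.Bijective (cellsToChains o k) then
    (LinearEquiv.ofBijective (cellsToChains o k) h).symm.toLinearMap ∘ₗ
      (singularCellularBoundary C k).hom ∘ₗ cellsToChains o (k + 1)
  else 0

open scoped Classical in
/-- The incidence numbers `⟨∂ b, j⟩`. -/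
def incidence (o : Orientation C) (k : ℕ) :
    Matrix (RelCWComplex.cell C k) (RelCWComplex.cell C (k + 1)) ℤ :=
  LinearMap.toMatrix' (integralBoundary o k)

/-- The cellular boundary `∂ : C_{k+1}(X; R) → C_k(X; R)`, where `C_k(X; R)` is the free
`R`-module on the set `X_k` of `k`-cells. -/
def boundary (o : Orientation C) (R : Type*) [CommRing R] (k : ℕ) :
    (RelCWComplex.cell C (k + 1) → R) →ₗ[R] (RelCWComplex.cell C k → R) :=
  ((incidence o k).map (Int.cast : ℤ → R)).mulVecLin

/-! ### Cellular homology -/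

/-- `Z_k(T; R)`. -/
def cycles (o : Orientation C) (T : CWComplex.Subcomplex C) (R : Type*) [CommRing R] :
    (k : ℕ) → Submodule R (RelCWComplex.cell C k → R)
  | 0 => chains T R 0
  | k + 1 => chains T R (k + 1) ⊓ LinearMap.ker (boundary o R k)

/-- `B_k(T; R)`. -/
def boundaries (o : Orientation C) (T : CWComplex.Subcomplex C) (R : Type*) [CommRing R] (k : ℕ) :
    Submodule R (RelCWComplex.cell C k → R) :=
  (chains T R (k + 1)).map (boundary o R k)

/-- Cellular homology `H_k(T; R) = Z_k(T; R) / B_k(T; R)`. -/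
abbrev Homology (o : Orientation C) (T : CWComplex.Subcomplex C) (R : Type*) [CommRing R]
    (k : ℕ) : Type _ :=
  cycles o T R k ⧸ (boundaries o T R k).submoduleOf (cycles o T R k)

/-- The Betti number `β_k(T)`. -/
def betti (o : Orientation C) (T : CWComplex.Subcomplex C) (k : ℕ) : ℕ :=
  Module.finrank ℝ (Homology o T ℝ k)

/-- The order of the torsion subgroup of an abelian group. -/
def torsionOrder (M : Type*) [AddCommGroup M] : ℕ :=
  Nat.card (AddCommGroup.torsion M)

/-- `T` is a spanning tree of the CW complex `X` of dimension `d = n + 1`: a subcomplex with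
`H_d(T; ℤ) = 0`, `β_{d-1}(T) = β_{d-1}(X)` and `X^(d-1) ⊆ T`. -/
structure IsSpanningTree (o : Orientation C) (n : ℕ) (T : CWComplex.Subcomplex C) : Prop where
  homology_eq_zero : Subsingleton (Homology o T ℤ (n + 1))
  betti_eq : betti o T n = betti o (whole C) n
  skeleton_subset : (CWComplex.skeleton C n : Set X) ⊆ T

open scoped Classical in
/-- The weight `w_T = θ_T² ∏_{b ∈ T_d} e^{-W_b}`, where `d = n + 1` and `θ_T` is the order of the
torsion subgroup of `H_{d-1}(T; ℤ)`. -/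
def treeWeight (o : Orientation C) (n : ℕ) (W : RelCWComplex.cell C (n + 1) → ℝ)
    (T : CWComplex.Subcomplex C) : ℝ :=
  (torsionOrder (Homology o T ℤ n) : ℝ) ^ 2 *
    ∏ b : RelCWComplex.cell C (n + 1) with b ∈ T.I (n + 1), (Real.exp (W b))⁻¹

/-! ### Lattices and the compressed Laplacian -/

/-- A homomorphism of abelian groups is a real isomorphism if it becomes an isomorphism after
tensoring with `ℝ`. -/
def IsRealIsomorphism {M N : Type*} [AddCommGroup M] [Module ℤ M] [AddCommGroup N] [Module ℤ N]
    (f : M →ₗ[ℤ] N) : Prop :=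
  Function.Bijective (f.baseChange ℝ)

/-- `t(f)`, the order of the torsion subgroup of the cokernel of `f`. -/
def cokerTorsion {M N : Type*} [AddCommGroup M] [Module ℤ M] [AddCommGroup N] [Module ℤ N]
    (f : M →ₗ[ℤ] N) : ℕ :=
  torsionOrder (N ⧸ LinearMap.range f)

/-- The inclusion `C_k(X; ℤ) → C_k(X; ℝ)`, the target with its standard inner product, for which
the cells are orthonormal. -/
def toReal {ι : Type*} (x : ι → ℤ) : EuclideanSpace ℝ ι :=
  WithLp.toLp 2 (fun i => (x i : ℝ))

/-- `A_ℝ`, as a subspace of `C_k(X; ℝ)`. -/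
def realSpan {ι : Type*} (A : Submodule ℤ (ι → ℤ)) : Submodule ℝ (EuclideanSpace ℝ ι) :=
  Submodule.span ℝ (toReal '' (A : Set (ι → ℤ)))

open scoped Classical in
/-- `μ(A)`, the determinant of the Gram matrix of a basis of `A`, which does not depend on the
basis; it is the square of the covolume of `A` in `A_ℝ`. -/
def gramDet {ι : Type*} [Fintype ι] (A : Submodule ℤ (ι → ℤ)) : ℝ :=
  (Matrix.gram ℝ (fun i => toReal (Module.Free.chooseBasis ℤ A i : ι → ℤ))).det

open scoped Classical in
/-- `∂ : C_{k+1}(X; ℝ) → C_k(X; ℝ)` between the chain groups with their standard inner products. -/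
def realBoundary (o : Orientation C) (k : ℕ) :
    EuclideanSpace ℝ (RelCWComplex.cell C (k + 1)) →ₗ[ℝ] EuclideanSpace ℝ (RelCWComplex.cell C k) :=
  Matrix.toEuclideanLin ((incidence o k).map (Int.cast : ℤ → ℝ))

open scoped Classical in
/-- `e^{-W}`, which maps a cell `b` to `e^{-W_b} b`. -/
def expNeg {ι : Type*} [Fintype ι] (W : ι → ℝ) : EuclideanSpace ℝ ι →ₗ[ℝ] EuclideanSpace ℝ ι :=
  Matrix.toEuclideanLin (Matrix.diagonal fun b => Real.exp (-W b))

/-- The orthogonal projection `P_A : B_k(X; ℝ) → A_ℝ`. -/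
def projection (o : Orientation C) (k : ℕ) (A : Submodule ℤ (RelCWComplex.cell C k → ℤ)) :
    LinearMap.range (realBoundary o k) →ₗ[ℝ] realSpan A :=
  (realSpan A).orthogonalProjectionOnto.toLinearMap.domRestrict _

/-- `L_A = P_A ∂ e^{-W} ∂^* : A_ℝ → A_ℝ`. -/
def compressedLaplacian (o : Orientation C) (k : ℕ) (W : RelCWComplex.cell C (k + 1) → ℝ)
    (A : Submodule ℤ (RelCWComplex.cell C k → ℤ)) : realSpan A →ₗ[ℝ] realSpan A :=
  projection o k A ∘ₗ (realBoundary o k).rangeRestrict ∘ₗ expNeg W ∘ₗ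
    LinearMap.adjoint (realBoundary o k) ∘ₗ (realSpan A).subtype

theorem toReal_mem_range (o : Orientation C) (k : ℕ) (x : boundaries o (whole C) ℤ k) :
    toReal (x : RelCWComplex.cell C k → ℤ) ∈ LinearMap.range (realBoundary o k) := by
  obtain ⟨x, z, -, rfl⟩ := x
  refine ⟨toReal z, ?_⟩
  ext i
  simp [realBoundary, toReal, boundary, Matrix.mulVec, dotProduct]

/-- `P_A` is induced by `p : B_k(X; ℤ) → A`: it agrees with `p` on the integral boundaries, which
span `B_k(X; ℝ)`. -/
def IsInducedBy (o : Orientation C) (k : ℕ) (A : Submodule ℤ (RelCWComplex.cell C k → ℤ))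
    (p : boundaries o (whole C) ℤ k →ₗ[ℤ] A) : Prop :=
  ∀ x : boundaries o (whole C) ℤ k,
    (projection o k A ⟨toReal (x : RelCWComplex.cell C k → ℤ), toReal_mem_range o k x⟩ :
      EuclideanSpace ℝ (RelCWComplex.cell C k)) = toReal (p x : RelCWComplex.cell C k → ℤ)

end MatrixTree

end

open CategoryTheory CategoryTheory.Limits Topology

namespace MatrixTree

/-! ### Integer matrices -/

/-! Let `β` have as columns a `ℤ`-basis of `B_{d-1}(X;ℤ)`. The incidence matrix factors as `β * E`,
where `E` is an integer matrix with a right inverse `F` (`exists_factorization`). Let the columns of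
`N` be a basis of `A`, and let `M` be the matrix of `p_A`. Orthogonality of the projection gives
`βᵀN = Mᵀ(NᵀN)`. Hence the compressed Laplacian has matrix `M (E e^{-W} Eᵀ) Mᵀ (NᵀN)`, and its
determinant is `μ(A) (det M)² det(E e^{-W} Eᵀ)` (`det_compressedLaplacian`). Since `p_A` is a real
isomorphism, its cokernel is finite of order `|det M| = t(p_A)`.

Cauchy–Binet expands the last factor as the sum of `(det E_S)² ∏_{b ∈ S} e^{-W_b}` over sets `S` of
`d`-cells whose size is the rank of `∂`. Adjoining the `(d-1)`-skeleton to `S` gives a subcomplex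
`T`, which is a spanning tree exactly when `det E_S ≠ 0` (`isSpanningTree_iff`). In that case `|det
E_S|` is the index of `B_{d-1}(T;ℤ)` in `B_{d-1}(X;ℤ)`. Both homology groups are quotients of the
same cycles, so `θ_T = |det E_S| θ_X`. The expansion is therefore `θ_X⁻² ∑_T w_T`
(`finsum_treeWeight`). -/

/-- The Cauchy–Binet formula, where `g S` enumerates the set `S`. -/
theorem det_mul_eq_sum_minors {R ι κ : Type*} [CommRing R] [Fintype ι] [DecidableEq ι] [Fintype κ]
    [DecidableEq κ] (M : Matrix ι κ R) (N : Matrix κ ι R) (g : Finset κ → ι → κ)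
    (hinj : ∀ S : Finset κ, S.card = Fintype.card ι → Function.Injective (g S))
    (himg : ∀ S : Finset κ, S.card = Fintype.card ι → Finset.univ.image (g S) = S) :
    (M * N).det = ∑ S : Finset κ with S.card = Fintype.card ι,
      (M.submatrix id (g S)).det * (N.submatrix (g S) id).det := by
  -- The rows of `M * N` are combinations of the rows of `N`; expand by multilinearity in the rows.
  have hexp : (M * N).det = ∑ f : ι → κ, (∏ i, M i (f i)) * (N.submatrix f id).det := by
    have h : (M * N) = fun i => ∑ k, M i k • N k := by
      ext i j
      simp [Matrix.mul_apply, Finset.sum_apply]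
    have := (Matrix.detRowAlternating (R := R) (n := ι)).toMultilinearMap.map_sum
      (fun i k => M i k • N k)
    have h2 : (M * N).det = ∑ f : ι → κ, Matrix.det (fun i => M i (f i) • N (f i)) := by
      rw [h]; exact this
    rw [h2]
    refine Finset.sum_congr rfl fun f _ => ?_
    exact (Matrix.detRowAlternating (R := R) (n := ι)).toMultilinearMap.map_smul_univ
      (fun i => M i (f i)) (fun i => N (f i))
  have hfib : ∀ S : Finset κ, S.card = Fintype.card ι →
      ∑ f : ι → κ with Function.Injective f ∧ Finset.univ.image f = S,
        (∏ i, M i (f i)) * (N.submatrix f id).det =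
      (M.submatrix id (g S)).det * (N.submatrix (g S) id).det := by
    intro S hS
    -- The injections with image `S` are exactly the `g S ∘ σ`, so the fibre over `S` is a sum over
    -- permutations and assembles into a minor of `M`.
    have h1 : ∑ f : ι → κ with Function.Injective f ∧ Finset.univ.image f = S,
        (∏ i, M i (f i)) * (N.submatrix f id).det =
        ∑ σ : Equiv.Perm ι, (∏ i, M i (g S (σ i))) * (N.submatrix (g S ∘ σ) id).det := by
      symm
      refine Finset.sum_bij (fun σ _ => g S ∘ σ) ?_ ?_ ?_ ?_
      · intro σ _
        simp only [Finset.mem_filter, Finset.mem_univ, true_and]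
        refine ⟨(hinj S hS).comp σ.injective, ?_⟩
        rw [← Finset.image_image, Finset.image_univ_of_surjective σ.surjective, himg S hS]
      · intro σ _ τ _ h
        ext i
        exact hinj S hS (congrFun h i)
      · intro f hf
        simp only [Finset.mem_filter, Finset.mem_univ, true_and] at hf
        have hex : ∀ i, ∃ j, g S j = f i := fun i => by
          have : f i ∈ Finset.univ.image (g S) := by
            rw [himg S hS, ← hf.2]
            exact Finset.mem_image_of_mem _ (Finset.mem_univ i)
          simpa using this
        choose p hp using hex
        have hpi : Function.Injective p := fun i j h => hf.1 (by rw [← hp, ← hp, h])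
        exact ⟨Equiv.ofBijective p (Finite.injective_iff_bijective.1 hpi), Finset.mem_univ _,
          funext hp⟩
      · intro σ _
        rfl
    rw [h1, ← Matrix.det_transpose (M.submatrix id (g S)), Matrix.det_apply', Finset.sum_mul]
    refine Finset.sum_congr rfl fun σ _ => ?_
    have : (N.submatrix (g S ∘ σ) id).det =
        (Equiv.Perm.sign σ : ℤ) * (N.submatrix (g S) id).det := by
      rw [← Matrix.det_permute]
      rfl
    rw [this]
    simp only [Matrix.transpose_apply, Matrix.submatrix_apply, id]
    ring
  have hzero : ∑ f : ι → κ with ¬ Function.Injective f,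
      (∏ i, M i (f i)) * (N.submatrix f id).det = 0 := by
    refine Finset.sum_eq_zero fun f hf => ?_
    simp only [Finset.mem_filter, Finset.mem_univ, true_and, Function.Injective, not_forall] at hf
    obtain ⟨i, j, hij, hne⟩ := hf
    rw [Matrix.det_zero_of_row_eq hne (by ext k; simp [hij]), mul_zero]
  rw [hexp, ← Finset.sum_filter_add_sum_filter_not Finset.univ
    (fun f : ι → κ => Function.Injective f), hzero, add_zero,
    ← Finset.sum_fiberwise_of_maps_to (g := fun f : ι → κ => Finset.univ.image f)
      (t := Finset.univ.filter fun S : Finset κ => S.card = Fintype.card ι)]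
  · refine Finset.sum_congr rfl fun S hS => ?_
    rw [Finset.filter_filter, hfib S (by simpa using hS)]
  · intro f hf
    simp only [Finset.mem_filter, Finset.mem_univ, true_and] at hf ⊢
    rw [Finset.card_image_of_injective _ hf, Finset.card_univ]

/-- An integer matrix with independent columns has a Gram matrix with nonzero determinant. -/
theorem det_transpose_mul_self_ne_zero {ι κ : Type*} [Fintype ι] [DecidableEq ι] [Fintype κ]
    (M : Matrix κ ι ℤ) (h : Function.Injective M.mulVec) : (M.transpose * M).det ≠ 0 := by
  intro h0
  obtain ⟨v, hv, hMv⟩ := Matrix.exists_mulVec_eq_zero_iff.2 h0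
  -- If `MᵀM v = 0`, then `|M v|² = vᵀMᵀM v = 0`; positivity is what makes this work.
  have h1 : dotProduct (M.mulVec v) (M.mulVec v) = 0 := by
    rw [← Matrix.mulVec_mulVec] at hMv
    rw [Matrix.dotProduct_mulVec, Matrix.vecMul_mulVec, ← Matrix.mulVec_transpose]
    simp [← Matrix.mulVec_mulVec, hMv]
  have h2 : M.mulVec v = 0 := dotProduct_self_eq_zero.1 h1
  exact hv (h (by rw [h2, Matrix.mulVec_zero]))

/-- Integer columns that are independent over `ℤ` are independent over `ℝ`. -/
theorem injective_mulVec_map_real {ι κ : Type*} [Fintype ι] [Fintype κ]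
    (M : Matrix κ ι ℤ) (h : Function.Injective M.mulVec) :
    Function.Injective (M.map (Int.cast : ℤ → ℝ)).mulVec := by
  classical
  -- Injectivity passes from `ℤ` to `ℝ` through the Gram determinant, a nonzero integer that stays
  -- nonzero after the cast.
  have hdet : ((M.map (Int.cast : ℤ → ℝ)).transpose * M.map (Int.cast : ℤ → ℝ)).det ≠ 0 := by
    have h1 : (M.map (Int.cast : ℤ → ℝ)).transpose * M.map (Int.cast : ℤ → ℝ) =
        (M.transpose * M).map (Int.castRingHom ℝ) := by
      rw [Matrix.map_mul]; rfl
    rw [h1, ← RingHom.mapMatrix_apply, ← RingHom.map_det]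
    simpa using det_transpose_mul_self_ne_zero M h
  have hinj := Matrix.mulVec_injective_of_isUnit
    ((Matrix.isUnit_iff_isUnit_det _).2 hdet.isUnit)
  intro v w hvw
  apply hinj
  change _ = _
  simp only [← Matrix.mulVec_mulVec]
  rw [show (M.map (Int.cast : ℤ → ℝ)).mulVec v = _ from hvw]

/-- The index of the image of a homomorphism of lattices of equal rank is its determinant. -/
theorem card_quotient_range_eq_natAbs_det {ι M N : Type*} [Fintype ι] [DecidableEq ι]
    [AddCommGroup M] [AddCommGroup N] (b : Module.Basis ι ℤ M) (c : Module.Basis ι ℤ N)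
    (f : M →ₗ[ℤ] N) (h : (LinearMap.toMatrix b c f).det ≠ 0) :
    Nat.card (N ⧸ LinearMap.range f) = (LinearMap.toMatrix b c f).det.natAbs := by
  have : Module.Free ℤ N := Module.Free.of_basis c
  have : Module.Finite ℤ N := Module.Finite.of_basis c
  have hinj : Function.Injective f := by
    rw [← LinearMap.ker_eq_bot]
    refine (LinearMap.ker_eq_bot').2 fun x hx => ?_
    have h1 : (LinearMap.toMatrix b c f).mulVec (b.repr x) = 0 := by
      rw [LinearMap.toMatrix_mulVec_repr, hx]; simp
    have h2 := Matrix.eq_zero_of_mulVec_eq_zero h h1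
    have : b.repr x = 0 := by ext i; exact congrFun h2 i
    simpa using this
  have := Submodule.natAbs_det_basis_change c (LinearMap.range f)
    (b.map (LinearEquiv.ofInjective f hinj))
  rw [← this, Module.Basis.det_apply]
  congr 2
  ext i j
  simp [LinearMap.toMatrix_apply, Module.Basis.toMatrix_apply]

/-! ### Torsion of quotients -/

theorem torsionOrder_of_finite (M : Type*) [AddCommGroup M] [Finite M] :
    torsionOrder M = Nat.card M := by
  have h : AddCommGroup.torsion M = ⊤ := eq_top_iff.2 fun x _ => isOfFinAddOrder_of_finite x
  rw [torsionOrder, h]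
  exact Nat.card_congr AddSubgroup.topEquiv.toEquiv

/-- Pulled back to `G`, the torsion is the saturation of `H`: the elements with a positive multiple
in `H`. Expressing its order as an index allows multiplication along a tower of subgroups. -/
theorem torsionOrder_quotient {G : Type*} [AddCommGroup G] (H : Submodule ℤ G) :
    torsionOrder (G ⧸ H) = H.toAddSubgroup.relIndex
      ((AddCommGroup.torsion (G ⧸ H)).comap (H.mkQ : G →+ G ⧸ H)) := by
  have h : H.toAddSubgroup = (⊥ : AddSubgroup (G ⧸ H)).comap (H.mkQ : G →+ G ⧸ H) := by
    ext x
    simp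
  conv_rhs => rw [h]
  rw [AddSubgroup.relIndex_comap, AddSubgroup.map_comap_eq_self_of_surjective,
    AddSubgroup.relIndex_bot_left, torsionOrder]
  exact H.mkQ_surjective

/-- Enlarging a submodule by finite index divides the torsion of the quotient by the index. -/
theorem torsionOrder_quotient_eq_mul {G : Type*} [AddCommGroup G] (K H : Submodule ℤ G)
    (hKH : K ≤ H) (hfin : K.toAddSubgroup.relIndex H.toAddSubgroup ≠ 0) :
    torsionOrder (G ⧸ K) =
      K.toAddSubgroup.relIndex H.toAddSubgroup * torsionOrder (G ⧸ H) := by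
  have mem_iff : ∀ (L : Submodule ℤ G) (x : G),
      x ∈ (AddCommGroup.torsion (G ⧸ L)).comap (L.mkQ : G →+ G ⧸ L) ↔
        ∃ m : ℕ, 0 < m ∧ m • x ∈ L := by
    intro L x
    rw [AddSubgroup.mem_comap]
    change IsOfFinAddOrder _ ↔ _
    rw [isOfFinAddOrder_iff_nsmul_eq_zero]
    refine exists_congr fun m => and_congr_right fun _ => ?_
    rw [← map_nsmul]
    exact Submodule.Quotient.mk_eq_zero L
  -- Finite index makes the two saturations coincide: a multiple lying in `H` has a further multiple
  -- in `K`.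
  have hsat : (AddCommGroup.torsion (G ⧸ K)).comap (K.mkQ : G →+ G ⧸ K) =
      (AddCommGroup.torsion (G ⧸ H)).comap (H.mkQ : G →+ G ⧸ H) := by
    ext x
    rw [mem_iff, mem_iff]
    constructor
    · rintro ⟨m, hm, hx⟩
      exact ⟨m, hm, hKH hx⟩
    · rintro ⟨m, hm, hx⟩
      obtain ⟨k, hk, -, hkx⟩ := AddSubgroup.exists_nsmul_mem_of_relIndex_ne_zero hfin hx
      exact ⟨k * m, by positivity, by rw [mul_nsmul']; exact hkx.1⟩
  rw [torsionOrder_quotient K, torsionOrder_quotient H, hsat]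
  refine (AddSubgroup.relIndex_mul_relIndex _ _ _ (fun x hx => hKH hx) fun x hx => ?_).symm
  exact (mem_iff H x).2 ⟨1, one_pos, by simpa using hx⟩

/-! ### The determinant of the compressed Laplacian -/

theorem injective_mulVec_basis {ι l : Type*} [Fintype ι] (B : Submodule ℤ (l → ℤ))
    (b : Module.Basis ι ℤ B) :
    Function.Injective (Matrix.of fun j i => (b i : l → ℤ) j : Matrix l ι ℤ).mulVec := by
  intro v w hvw
  have : ∀ v : ι → ℤ, (Matrix.of fun j i => (b i : l → ℤ) j : Matrix l ι ℤ).mulVec v =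
      ((∑ i, v i • b i : B) : l → ℤ) := fun v => by
    ext j
    simp [Matrix.mulVec, dotProduct, mul_comm]
  rw [this, this] at hvw
  have h2 := Subtype.ext hvw
  rw [← b.equivFun_symm_apply, ← b.equivFun_symm_apply] at h2
  exact b.equivFun.symm.injective h2

/-- A matrix whose columns span a lattice `B` factors through any basis of `B`: the first factor
has the basis vectors as columns and the second one is surjective. -/
theorem exists_factorization {ι κ l : Type*} [Fintype ι] [DecidableEq ι] [Fintype κ]
    [DecidableEq κ] (D : Matrix l κ ℤ) (B : Submodule ℤ (l → ℤ))
    (hB : B = LinearMap.range D.mulVecLin) (b : Module.Basis ι ℤ B) :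
    ∃ (E : Matrix ι κ ℤ) (F : Matrix κ ι ℤ),
      D = (Matrix.of fun j i => (b i : l → ℤ) j) * E ∧ E * F = 1 := by
  have hmem : ∀ x, D.mulVec x ∈ B := fun x => by rw [hB]; exact ⟨x, rfl⟩
  -- Column `c` of `E` holds the coordinates of the `c`-th column of `D` in the basis `b`; the
  -- columns of `F` are preimages under `D` of the basis vectors.
  let E : Matrix ι κ ℤ := Matrix.of fun i c => b.repr ⟨D.mulVec (Pi.single c 1), hmem _⟩ i
  have hex : ∀ i, ∃ x, D.mulVec x = (b i : l → ℤ) := fun i => by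
    obtain ⟨x, hx⟩ := hB.le (b i).2
    exact ⟨x, hx⟩
  choose f hf using hex
  have hD : D = (Matrix.of fun j i => (b i : l → ℤ) j) * E := by
    ext j c
    have h := congrArg (fun y : B => (y : l → ℤ) j) (b.sum_repr ⟨D.mulVec (Pi.single c 1), hmem _⟩)
    simp only [Submodule.coe_sum, Submodule.coe_smul, Finset.sum_apply, Pi.smul_apply,
      smul_eq_mul, Matrix.mulVec_single_one, Matrix.col_apply] at h
    rw [← h, Matrix.mul_apply]
    refine Finset.sum_congr rfl fun i _ => ?_
    simp [E, mul_comm]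
  refine ⟨E, Matrix.of fun c i => f i c, hD, ?_⟩
  have hinj := injective_mulVec_basis B b
  -- Since `β E F = D F = β`, the injective `β` cancels to give `E F = 1`.
  ext i i'
  have h1 : (Matrix.of fun j i => (b i : l → ℤ) j : Matrix l ι ℤ).mulVec
      ((E * Matrix.of fun c i => f i c).col i') =
      (Matrix.of fun j i => (b i : l → ℤ) j : Matrix l ι ℤ).mulVec ((1 : Matrix ι ι ℤ).col i') := by
    rw [← Matrix.mulVec_single_one, ← Matrix.mulVec_single_one, Matrix.mulVec_mulVec,
      Matrix.mulVec_mulVec, ← Matrix.mul_assoc, ← hD, Matrix.mul_one, ← Matrix.mulVec_mulVec,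
      Matrix.mulVec_single_one, Matrix.mulVec_single_one]
    exact hf i'
  exact congrFun (hinj h1) i

theorem toReal_mem_realSpan {l : Type*} (A : Submodule ℤ (l → ℤ)) (x : A) :
    toReal (x : l → ℤ) ∈ realSpan A :=
  Submodule.subset_span ⟨x, x.2, rfl⟩

theorem toReal_sum_smul {ι l : Type*} [Fintype ι] (c : ι → ℤ) (v : ι → l → ℤ) :
    toReal (∑ i, c i • v i) = ∑ i, (c i : ℝ) • toReal (v i) := by
  ext j
  simp [toReal, Finset.sum_apply]

/-- A basis of a lattice `A` is a basis of its real span. -/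
theorem exists_basis_realSpan {ι l : Type*} [Fintype ι] [Fintype l] (A : Submodule ℤ (l → ℤ))
    (a : Module.Basis ι ℤ A) :
    ∃ r : Module.Basis ι ℝ (realSpan A), ∀ i,
      (r i : EuclideanSpace ℝ l) = toReal (a i : l → ℤ) := by
  classical
  have hinj := injective_mulVec_map_real _ (injective_mulVec_basis A a)
  have hli : LinearIndependent ℝ fun i => (⟨toReal (a i : l → ℤ), toReal_mem_realSpan A (a i)⟩ :
      realSpan A) := by
    rw [Fintype.linearIndependent_iff]
    intro g hg
    have h1 := congrArg (Subtype.val) hg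
    have : g = 0 := by
      apply hinj
      rw [Matrix.mulVec_zero]
      ext j
      have h2 := congrArg (fun y : EuclideanSpace ℝ l => y j) h1
      simp [toReal] at h2
      rw [Pi.zero_apply, ← h2]
      simp [Matrix.mulVec, dotProduct, mul_comm]
    exact congrFun this
  have hsp : ⊤ ≤ Submodule.span ℝ (Set.range fun i =>
      (⟨toReal (a i : l → ℤ), toReal_mem_realSpan A (a i)⟩ : realSpan A)) := by
    rintro ⟨x, hx⟩ -
    have key : realSpan A ≤ (Submodule.span ℝ (Set.range fun i =>
      (⟨toReal (a i : l → ℤ), toReal_mem_realSpan A (a i)⟩ : realSpan A))).map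
        (realSpan A).subtype := by
      refine Submodule.span_le.2 ?_
      rintro _ ⟨y, hy, rfl⟩
      have h := congrArg (fun z : A => toReal (z : l → ℤ)) (a.sum_repr ⟨y, hy⟩)
      simp only [Submodule.coe_sum, Submodule.coe_smul] at h
      rw [toReal_sum_smul] at h
      rw [← h]
      refine Submodule.sum_mem _ fun i _ => Submodule.smul_mem _ _ ?_
      exact ⟨_, Submodule.subset_span ⟨i, rfl⟩, rfl⟩
    obtain ⟨y, hy, hxy⟩ := key hx
    have : y = ⟨x, hx⟩ := Subtype.ext hxy
    exact this ▸ hy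
  exact ⟨Module.Basis.mk hli hsp, fun i => by rw [Module.Basis.mk_apply]⟩

section Laplacian

variable {X : Type*} [TopologicalSpace X] [T2Space X] {C : Set X} [CWComplex C]
  [∀ k, Fintype (RelCWComplex.cell C k)]

open scoped Classical in
/-- The compressed Laplacian reduces to a weighted Gram determinant when the boundary matrix is
factored through a basis of the integral boundaries. -/
theorem det_compressedLaplacian (o : Orientation C) (k : ℕ) (W : RelCWComplex.cell C (k + 1) → ℝ)
    (A : Submodule ℤ (RelCWComplex.cell C k → ℤ))
    (p : boundaries o (whole C) ℤ k →ₗ[ℤ] A) (hpA : IsInducedBy o k A p)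
    {ι : Type*} [Fintype ι] (b : Module.Basis ι ℤ (boundaries o (whole C) ℤ k))
    (a : Module.Basis ι ℤ A) (E : Matrix ι (RelCWComplex.cell C (k + 1)) ℤ)
    (hE : incidence o k = (Matrix.of fun j i => (b i : RelCWComplex.cell C k → ℤ) j) * E) :
    LinearMap.det (compressedLaplacian o k W A) =
      (Matrix.gram ℝ (fun i => toReal (a i : RelCWComplex.cell C k → ℤ))).det *
        ((LinearMap.toMatrix b a p).det : ℝ) ^ 2 *
        (E.map (Int.cast : ℤ → ℝ) * Matrix.diagonal (fun c => Real.exp (-W c)) *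
          (E.map (Int.cast : ℤ → ℝ)).transpose).det := by
  set β : Matrix (RelCWComplex.cell C k) ι ℝ :=
    (Matrix.of fun j i => (b i : RelCWComplex.cell C k → ℤ) j).map (Int.cast : ℤ → ℝ) with hβ
  set N : Matrix (RelCWComplex.cell C k) ι ℝ :=
    (Matrix.of fun j i => (a i : RelCWComplex.cell C k → ℤ) j).map (Int.cast : ℤ → ℝ) with hN
  set Er := E.map (Int.cast : ℤ → ℝ) with hEr
  set Λ := Matrix.diagonal (fun c => Real.exp (-W c)) with hΛ
  set M := (LinearMap.toMatrix b a p).map (Int.cast : ℤ → ℝ) with hM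
  have hD : (incidence o k).map (Int.cast : ℤ → ℝ) = β * Er := by
    rw [hE]
    exact Matrix.map_mul (f := Int.castRingHom ℝ)
  have hB : realBoundary o k = Matrix.toEuclideanLin (β * Er) := by
    rw [← hD]
    rfl
  have hgram : Matrix.gram ℝ (fun i => toReal (a i : RelCWComplex.cell C k → ℤ)) =
      N.transpose * N := by
    ext i j
    simp [toReal, Matrix.mul_apply, hN, PiLp.inner_apply, mul_comm]
  obtain ⟨r, hr⟩ := exists_basis_realSpan A a
  have hproj : ∀ i, projection o k A ⟨toReal (b i : RelCWComplex.cell C k → ℤ),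
      toReal_mem_range o k (b i)⟩ = ∑ l, M l i • r l := by
    intro i
    apply Subtype.ext
    rw [hpA (b i)]
    have h := a.sum_repr (p (b i))
    conv_lhs => rw [← h]
    simp only [Submodule.coe_sum, Submodule.coe_smul, toReal_sum_smul, hr]
    refine Finset.sum_congr rfl fun l _ => ?_
    simp [hM, LinearMap.toMatrix_apply]
  -- Pairing `b i` with a vector of `A_ℝ` sees only its projection, whose coordinates are column `i`
  -- of `M`.
  have hinner : β.transpose * N = M.transpose * (N.transpose * N) := by
    ext i j
    have h1 : (β.transpose * N) i j = inner ℝ (toReal (b i : RelCWComplex.cell C k → ℤ))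
        (r j : EuclideanSpace ℝ _) := by
      rw [hr]
      simp [toReal, Matrix.mul_apply, hN, hβ, PiLp.inner_apply, mul_comm]
    rw [h1, ← Submodule.inner_orthogonalProjectionOnto_eq_of_mem_right]
    have h2 : (realSpan A).orthogonalProjectionOnto (toReal (b i : RelCWComplex.cell C k → ℤ)) =
      ∑ l, M l i • r l := hproj i
    rw [h2, sum_inner, ← hgram, Matrix.mul_apply]
    refine Finset.sum_congr rfl fun l _ => ?_
    rw [real_inner_smul_left, Matrix.gram_apply, ← hr, ← hr]
    rfl
  -- Column `j` of `G` gives the coordinates of `∂ e^{-W} ∂^*` applied to the `j`-th basis vector of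
  -- `A`, in the basis `b`.
  set G := Er * Λ * Er.transpose * (β.transpose * N) with hG
  have hL : LinearMap.toMatrix r r (compressedLaplacian o k W A) = M * G := by
    ext l j
    rw [LinearMap.toMatrix_apply]
    have h0 : realBoundary o k (expNeg W (LinearMap.adjoint (realBoundary o k)
        (WithLp.toLp 2 (N.col j)))) =
        ∑ i, G i j • toReal (b i : RelCWComplex.cell C k → ℤ) := by
      rw [hB, ← Matrix.toEuclideanLin_conjTranspose_eq_adjoint, expNeg, ← hΛ,
        Matrix.conjTranspose_eq_transpose_of_trivial]
      simp only [Matrix.toLpLin_toLp, Matrix.toLin'_apply]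
      have h3 : β * Er * Λ * (β * Er).transpose * N = β * G := by
        rw [Matrix.transpose_mul, hG]
        simp only [Matrix.mul_assoc]
      rw [← Matrix.mulVec_single_one N j]
      simp only [Matrix.mulVec_mulVec, ← Matrix.mul_assoc]
      rw [h3, ← Matrix.mulVec_mulVec, Matrix.mulVec_single_one]
      ext c
      simp only [WithLp.ofLp_sum, WithLp.ofLp_smul, Finset.sum_apply, Pi.smul_apply, smul_eq_mul]
      exact Finset.sum_congr rfl fun i _ => mul_comm _ _
    have h1 : (realBoundary o k).rangeRestrict (expNeg W
        (LinearMap.adjoint (realBoundary o k) (r j : EuclideanSpace ℝ _))) =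
        ∑ i, G i j • ⟨toReal (b i : RelCWComplex.cell C k → ℤ), toReal_mem_range o k (b i)⟩ := by
      apply Subtype.ext
      rw [hr, Submodule.coe_sum]
      exact h0
    have h2 : compressedLaplacian o k W A (r j) = ∑ l, (M * G) l j • r l := by
      change projection o k A ((realBoundary o k).rangeRestrict (expNeg W
        (LinearMap.adjoint (realBoundary o k) (r j : EuclideanSpace ℝ _)))) = _
      rw [h1, map_sum]
      simp only [map_smul, hproj, Matrix.mul_apply, Finset.smul_sum, Finset.sum_smul, smul_smul]
      rw [Finset.sum_comm]
      refine Finset.sum_congr rfl fun l _ => Finset.sum_congr rfl fun i _ => ?_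
      rw [mul_comm]
    rw [h2, ← r.equivFun_symm_apply, ← r.equivFun_apply, LinearEquiv.apply_symm_apply]
  rw [← LinearMap.det_toMatrix r, hL, hG, hinner, hgram]
  have hMd : M.det = ((LinearMap.toMatrix b a p).det : ℝ) := by
    rw [hM]
    exact (RingHom.map_det (Int.castRingHom ℝ) _).symm
  simp only [Matrix.det_mul, Matrix.det_transpose, ← hMd]
  ring

end Laplacian

/-! ### Cellular chains of subcomplexes -/

/-- Columns outside the image of `g` contribute nothing. This turns chains supported on a subcomplex
into arguments of a column submatrix. -/
theorem mulVec_eq_submatrix_mulVec {R ι κ l : Type*} [CommRing R] [Fintype ι] [Fintype κ]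
    (D : Matrix l κ R) (g : ι → κ) (hg : Function.Injective g) (x : κ → R)
    (hx : ∀ c, c ∉ Set.range g → x c = 0) :
    D.mulVec x = (D.submatrix id g).mulVec (x ∘ g) := by
  ext j
  exact (Fintype.sum_of_injective g hg _ _ (fun c hc => by rw [hx c hc, mul_zero])
    fun _ => rfl).symm

theorem exists_extension {R ι κ : Type*} [CommRing R] (g : ι → κ) (hg : Function.Injective g)
    (y : ι → R) : ∃ x : κ → R, (∀ c, c ∉ Set.range g → x c = 0) ∧ x ∘ g = y :=
  ⟨Function.extend g y fun _ => 0, fun _ hc => Function.extend_apply' _ _ _ hc,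
    funext fun i => hg.extend_apply y _ i⟩

section Subcomplexes

variable {X : Type*} [TopologicalSpace X] {C : Set X} [CWComplex C]

/-- The open cell of a cell outside `T` is disjoint from `T`, yet open cells are nonempty. -/
theorem mem_cells_of_openCell_subset (T : CWComplex.Subcomplex C) {m : ℕ}
    {e : RelCWComplex.cell C m} (h : RelCWComplex.openCell m e ⊆ (T : Set X)) : e ∈ T.I m := by
  by_contra he
  have := RelCWComplex.Subcomplex.disjoint_openCell_subcomplex_of_not_mem T he
  obtain ⟨x, hx⟩ := RelCWComplex.openCell_nonempty (C := C) m e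
  exact Set.disjoint_left.1 this hx (h hx)

theorem chains_eq_top (T : CWComplex.Subcomplex C) (R : Type*) [CommRing R] {k : ℕ}
    (h : T.I k = Set.univ) : chains T R k = ⊤ :=
  eq_top_iff.2 fun _ _ e he => absurd (h ▸ Set.mem_univ e) he

variable [T2Space X]

theorem cells_eq_univ_of_skeleton_subset (T : CWComplex.Subcomplex C) {n : ℕ}
    (h : (CWComplex.skeleton C n : Set X) ⊆ T) {m : ℕ} (hm : m ≤ n) : T.I m = Set.univ := by
  refine Set.eq_univ_of_forall fun e => mem_cells_of_openCell_subset T ?_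
  exact (CWComplex.openCell_subset_skeleton m e).trans
    ((CWComplex.skeleton_mono (by exact_mod_cast hm)).trans h)

/-- A subcomplex of a complex of dimension `n + 1` containing the `n`-skeleton is determined by its
top-dimensional cells. -/
theorem eq_of_top_cells_eq {n : ℕ} (hdim : ∀ m, n + 1 < m → IsEmpty (RelCWComplex.cell C m))
    {S T : CWComplex.Subcomplex C} (hS : (CWComplex.skeleton C n : Set X) ⊆ S)
    (hT : (CWComplex.skeleton C n : Set X) ⊆ T) (h : S.I (n + 1) = T.I (n + 1)) : S = T := by
  have hI : S.I = T.I := by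
    funext m
    rcases lt_trichotomy m (n + 1) with hm | rfl | hm
    · rw [cells_eq_univ_of_skeleton_subset S hS (Nat.le_of_lt_succ hm),
        cells_eq_univ_of_skeleton_subset T hT (Nat.le_of_lt_succ hm)]
    · exact h
    · have := hdim m hm
      exact Subsingleton.elim _ _
  refine SetLike.coe_injective ?_
  rw [← CWComplex.Subcomplex.union (E := S), ← CWComplex.Subcomplex.union (E := T), hI]

/-- Any set of `(n + 1)`-cells, together with the `n`-skeleton, forms a subcomplex. -/
theorem exists_subcomplex_top_cells (n : ℕ) (S : Set (RelCWComplex.cell C (n + 1))) :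
    ∃ T : CWComplex.Subcomplex C, (CWComplex.skeleton C n : Set X) ⊆ T ∧ T.I (n + 1) = S := by
  -- Equality in the sigma type compares an `m`-cell with an `(n + 1)`-cell without transporting
  -- along `m = n + 1`.
  let I : ∀ m, Set (RelCWComplex.cell C m) := fun m => {e | m ≤ n ∨
    ∃ b ∈ S, (⟨m, e⟩ : Σ m, RelCWComplex.cell C m) = ⟨n + 1, b⟩}
  have hI : ∀ m (e : RelCWComplex.cell C m), e ∈ I m → m ≤ n + 1 := by
    rintro m e (h | ⟨b, -, h⟩)
    · omega
    · exact (congrArg Sigma.fst h).le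
  let E : Set X := ⋃ (m : ℕ) (e : I m), RelCWComplex.openCell m e.1
  have hE : ∀ m (e : RelCWComplex.cell C m), e ∈ I m → RelCWComplex.openCell m e ⊆ E :=
    fun m e he => Set.subset_iUnion_of_subset m (Set.subset_iUnion_of_subset ⟨e, he⟩ subset_rfl)
  have hlow : ∀ m : ℕ, m ≤ n + 1 → (CWComplex.skeletonLT C m : Set X) ⊆ E := by
    intro m hm x hx
    obtain ⟨k, hk, e, hxe⟩ := CWComplex.mem_skeletonLT_iff.1 hx
    have hk' : k < m := by exact_mod_cast hk
    exact hE k e (Or.inl (by omega)) hxe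
  refine ⟨CWComplex.Subcomplex.mk' C E I ?_ rfl, ?_, ?_⟩
  · intro m e
    rw [← RelCWComplex.cellFrontier_union_openCell_eq_closedCell]
    exact Set.union_subset ((CWComplex.cellFrontier_subset_skeletonLT m e.1).trans
      (hlow m (hI m e.1 e.2))) (hE m e.1 e.2)
  · exact_mod_cast hlow (n + 1) le_rfl
  · ext e
    change (n + 1 ≤ n ∨ _) ↔ _
    simp

/-! ### Cycles and boundaries in the cellular complex -/

/-- The two middle maps of the fourfold composite are consecutive in the long exact sequence of one
pair. -/
theorem singularCellularBoundary_apply_apply (k : ℕ)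
    (z : relHomology (skeletonPair C (k + 2)) (k + 2)) :
    (singularCellularBoundary C k).hom ((singularCellularBoundary C (k + 1)).hom z) = 0 := by
  have h : toRelHomology (skeletonPair C (k + 1)) (k + 1) ≫ connecting (skeletonPair C (k + 1)) k
      = 0 := (pairShortComplex_shortExact (skeletonPair C (k + 1))).comp_δ (k + 1) k rfl
  have h' : ∀ y, (connecting (skeletonPair C (k + 1)) k).hom
      ((toRelHomology (skeletonPair C (k + 1)) (k + 1)).hom y) = 0 := fun y =>
    congrArg (fun f => f.hom y) h
  change (toRelHomology (skeletonPair C k) k).hom ((connecting (skeletonPair C (k + 1)) k).hom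
    ((toRelHomology (skeletonPair C (k + 1)) (k + 1)).hom _)) = 0
  exact (congrArg _ (h' _)).trans (map_zero _)

variable [∀ k, Fintype (RelCWComplex.cell C k)]

theorem integralBoundary_comp (o : Orientation C) (k : ℕ) :
    integralBoundary o k ∘ₗ integralBoundary o (k + 1) = 0 := by
  unfold integralBoundary
  split_ifs with h1 h2 h2
  -- The inverse of `cellsToChains` ending one boundary cancels against the `cellsToChains` starting
  -- the next. In the other cases one factor is the default `0`.
  · ext1 x
    have h3 : ∀ y, cellsToChains o (k + 1)
      ((LinearEquiv.ofBijective (cellsToChains o (k + 1)) h2).symm y) = y :=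
      (LinearEquiv.ofBijective (cellsToChains o (k + 1)) h2).apply_symm_apply
    simp only [LinearMap.comp_apply, LinearEquiv.coe_coe, h3, singularCellularBoundary_apply_apply]
    simp
  all_goals simp

theorem boundary_boundary (o : Orientation C) (R : Type*) [CommRing R] (k : ℕ)
    (x : RelCWComplex.cell C (k + 2) → R) : boundary o R k (boundary o R (k + 1) x) = 0 := by
  classical
  have h : incidence o k * incidence o (k + 1) = 0 := by
    have := integralBoundary_comp o k
    unfold incidence
    rw [← LinearMap.toMatrix'_comp, this, map_zero]
  have h2 : (incidence o k).map (Int.castRingHom R) *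
      (incidence o (k + 1)).map (Int.castRingHom R) = 0 := by
    rw [← Matrix.map_mul, h, Matrix.map_zero _ (map_zero _)]
  change ((incidence o k).map (Int.castRingHom R)).mulVec
    (((incidence o (k + 1)).map (Int.castRingHom R)).mulVec x) = 0
  rw [Matrix.mulVec_mulVec, h2, Matrix.zero_mulVec]

theorem boundaries_whole (o : Orientation C) (R : Type*) [CommRing R] (k : ℕ) :
    boundaries o (whole C) R k = LinearMap.range (boundary o R k) := by
  rw [boundaries, chains_eq_top (whole C) R rfl, Submodule.map_top]

theorem boundaries_le_whole (o : Orientation C) (T : CWComplex.Subcomplex C) (R : Type*)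
    [CommRing R] (k : ℕ) : boundaries o T R k ≤ boundaries o (whole C) R k := by
  rw [boundaries_whole]
  exact LinearMap.map_le_range

theorem cycles_eq_whole (o : Orientation C) (T : CWComplex.Subcomplex C) (R : Type*) [CommRing R]
    {k : ℕ} (h : T.I k = Set.univ) : cycles o T R k = cycles o (whole C) R k := by
  have h' : (whole C).I k = Set.univ := rfl
  cases k <;> simp only [cycles, chains_eq_top T R h, chains_eq_top (whole C) R h']

theorem boundaries_whole_le_cycles (o : Orientation C) (R : Type*) [CommRing R] (k : ℕ) :
    boundaries o (whole C) R k ≤ cycles o (whole C) R k := by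
  rw [boundaries_whole]
  rintro _ ⟨x, rfl⟩
  cases k with
  | zero => exact fun e he => absurd (Set.mem_univ e) he
  | succ k => exact ⟨fun e he => absurd (Set.mem_univ e) he, boundary_boundary o R k x⟩

theorem boundaries_eq_range (o : Orientation C) (T : CWComplex.Subcomplex C) (R : Type*)
    [CommRing R] (k : ℕ) {ι : Type*} [Fintype ι] (g : ι → RelCWComplex.cell C (k + 1))
    (hg : Function.Injective g) (hT : Set.range g = T.I (k + 1)) :
    boundaries o T R k =
      LinearMap.range (((incidence o k).submatrix id g).map (Int.cast : ℤ → R)).mulVecLin := by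
  have h := mulVec_eq_submatrix_mulVec ((incidence o k).map (Int.cast : ℤ → R)) g hg
  ext y
  constructor
  · rintro ⟨x, hx, rfl⟩
    exact ⟨x ∘ g, (h x (hT ▸ hx)).symm⟩
  · rintro ⟨x, rfl⟩
    obtain ⟨z, hz, rfl⟩ := exists_extension g hg x
    exact ⟨z, (hT ▸ hz : ∀ e, e ∉ T.I (k + 1) → z e = 0), h z hz⟩

/-! ### Ranks, Betti numbers and the matroid of spanning trees -/

theorem finrank_range_of_injective {ι l : Type*} [Fintype ι] [Fintype l] (M : Matrix l ι ℤ)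
    (h : Function.Injective M.mulVec) :
    Module.finrank ℝ (LinearMap.range (M.map (Int.cast : ℤ → ℝ)).mulVecLin) = Fintype.card ι := by
  rw [LinearMap.finrank_range_of_inj (injective_mulVec_map_real M h),
    Module.finrank_fintype_fun_eq_card]

/-- A subcomplex with all `k`-cells has the same `k`-cycles as `X`, so comparing Betti numbers
amounts to comparing ranks of boundaries. -/
theorem betti_add (o : Orientation C) (T : CWComplex.Subcomplex C) {k : ℕ}
    (h : T.I k = Set.univ) :
    betti o T k + Module.finrank ℝ (boundaries o T ℝ k) =
      Module.finrank ℝ (cycles o (whole C) ℝ k) := by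
  have hle : boundaries o T ℝ k ≤ cycles o T ℝ k := by
    rw [cycles_eq_whole o T ℝ h]
    exact (boundaries_le_whole o T ℝ k).trans (boundaries_whole_le_cycles o ℝ k)
  rw [← cycles_eq_whole o T ℝ h, betti,
    ← (Submodule.submoduleOfEquivOfLe hle).finrank_eq, Submodule.finrank_quotient_add_finrank]

/-- Without `(n + 2)`-cells there are no boundaries in degree `n + 1`, so the homology is the kernel
of `∂` on the cells of `T`. -/
theorem subsingleton_homology_iff (o : Orientation C) (T : CWComplex.Subcomplex C) {n : ℕ}
    (hdim : IsEmpty (RelCWComplex.cell C (n + 2))) {ι : Type*} [Fintype ι]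
    (g : ι → RelCWComplex.cell C (n + 1)) (hg : Function.Injective g)
    (hT : Set.range g = T.I (n + 1)) :
    Subsingleton (Homology o T ℤ (n + 1)) ↔
      Function.Injective ((incidence o n).submatrix id g).mulVec := by
  have hb : boundaries o T ℤ (n + 1) = ⊥ := by
    rw [eq_bot_iff]
    rintro _ ⟨x, -, rfl⟩
    rw [Subsingleton.elim x 0, map_zero]
    exact zero_mem _
  have hbd : ∀ x, boundary o ℤ n x = (incidence o n).mulVec x := fun x => by
    simp [boundary, show (Int.cast : ℤ → ℤ) = id from rfl]
  rw [Submodule.Quotient.subsingleton_iff, Submodule.submoduleOf_eq_top, hb, le_bot_iff,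
    eq_bot_iff]
  change _ ↔ Function.Injective ((incidence o n).submatrix id g).mulVecLin
  rw [← LinearMap.ker_eq_bot, LinearMap.ker_eq_bot']
  constructor
  · intro h y hy
    obtain ⟨z, hz, rfl⟩ := exists_extension g hg y
    have : z = 0 := h ⟨(hT ▸ hz : ∀ e, e ∉ T.I (n + 1) → z e = 0), by
      rw [SetLike.mem_coe, LinearMap.mem_ker, hbd, mulVec_eq_submatrix_mulVec _ g hg z hz]
      exact hy⟩
    rw [this]
    rfl
  · rintro h x ⟨hx, hx0⟩
    have hx' : ∀ e, e ∉ Set.range g → x e = 0 := hT ▸ hx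
    rw [SetLike.mem_coe, LinearMap.mem_ker, hbd, mulVec_eq_submatrix_mulVec _ g hg x hx'] at hx0
    have h0 := h _ hx0
    refine (Submodule.mem_bot ℤ).2 (funext fun e => ?_)
    by_cases he : e ∈ Set.range g
    · obtain ⟨i, rfl⟩ := he
      exact congrFun h0 i
    · exact hx' e he

/-- Spanning trees are the bases of the column matroid of the boundary matrix. -/
theorem isSpanningTree_iff (o : Orientation C) (T : CWComplex.Subcomplex C) {n : ℕ}
    (hdim : IsEmpty (RelCWComplex.cell C (n + 2)))
    (hskel : (CWComplex.skeleton C n : Set X) ⊆ T) {ι : Type*} [Fintype ι]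
    (g : ι → RelCWComplex.cell C (n + 1)) (hg : Function.Injective g)
    (hT : Set.range g = T.I (n + 1)) :
    IsSpanningTree o n T ↔ Function.Injective ((incidence o n).submatrix id g).mulVec ∧
      Fintype.card ι = Module.finrank ℝ (boundaries o (whole C) ℝ n) := by
  have hb := betti_add o T (cells_eq_univ_of_skeleton_subset T hskel le_rfl)
  have hb' := betti_add o (whole C) (k := n) rfl
  have hfin : Function.Injective ((incidence o n).submatrix id g).mulVec →
      Module.finrank ℝ (boundaries o T ℝ n) = Fintype.card ι := fun h => by
    rw [boundaries_eq_range o T ℝ n g hg hT, finrank_range_of_injective _ h]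
  constructor
  · intro h
    have h1 := (subsingleton_homology_iff o T hdim g hg hT).1 h.homology_eq_zero
    have h2 := h.betti_eq
    have h3 := hfin h1
    exact ⟨h1, by omega⟩
  · rintro ⟨h1, h2⟩
    have h3 := hfin h1
    exact ⟨(subsingleton_homology_iff o T hdim g hg hT).2 h1, by omega, hskel⟩

end Subcomplexes

/-! ### Weights of spanning trees -/

theorem torsionOrder_ne_zero (M : Type*) [AddCommGroup M] [Module.Finite ℤ M] :
    torsionOrder M ≠ 0 := by
  have : Module.Finite ℤ (AddCommGroup.torsion M).toIntSubmodule := inferInstance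
  have : AddGroup.FG (AddCommGroup.torsion M) := Module.Finite.iff_addGroup_fg.1 this
  have : Finite (AddCommGroup.torsion M) :=
    AddCommGroup.finite_of_fg_isAddTorsion _ fun x => by
      have h : IsOfFinAddOrder (x : M) := x.2
      exact (AddSubmonoid.isOfFinAddOrder_coe).1 h
  exact Nat.card_pos.ne'

theorem map_intCast_int {l κ : Type*} (M : Matrix l κ ℤ) : M.map (Int.cast : ℤ → ℤ) = M := by
  ext
  simp

theorem injective_mul_mulVec_iff {ι l : Type*} [Fintype ι] [DecidableEq ι]
    (B : Matrix l ι ℤ) (hB : Function.Injective B.mulVec) (M : Matrix ι ι ℤ) :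
    Function.Injective (B * M).mulVec ↔ M.det ≠ 0 := by
  have h1 : (B * M).mulVec = B.mulVec ∘ M.mulVec := funext fun v => by
    simp [Matrix.mulVec_mulVec]
  rw [h1, hB.of_comp_iff]
  constructor
  · intro h h0
    obtain ⟨v, hv, hMv⟩ := Matrix.exists_mulVec_eq_zero_iff.2 h0
    exact hv (h (by rw [hMv, Matrix.mulVec_zero]))
  · intro h
    change Function.Injective M.mulVecLin
    rw [← LinearMap.ker_eq_bot, LinearMap.ker_eq_bot']
    exact fun v hv => Matrix.eq_zero_of_mulVec_eq_zero h hv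

/-- The Cauchy–Binet expansion of a weighted Gram determinant. -/
theorem det_mul_diagonal_mul_transpose {R ι κ : Type*} [CommRing R] [Fintype ι] [DecidableEq ι]
    [Fintype κ] [DecidableEq κ] (E : Matrix ι κ R) (w : κ → R) (g : Finset κ → ι → κ)
    (hinj : ∀ S : Finset κ, S.card = Fintype.card ι → Function.Injective (g S))
    (himg : ∀ S : Finset κ, S.card = Fintype.card ι → Finset.univ.image (g S) = S) :
    (E * Matrix.diagonal w * E.transpose).det = ∑ S : Finset κ with S.card = Fintype.card ι,
      (E.submatrix id (g S)).det ^ 2 * ∏ c ∈ S, w c := by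
  rw [det_mul_eq_sum_minors _ _ g hinj himg]
  refine Finset.sum_congr rfl fun S hS => ?_
  have hS' : S.card = Fintype.card ι := by simpa using hS
  have h1 : (E * Matrix.diagonal w).submatrix id (g S) =
      E.submatrix id (g S) * Matrix.diagonal (w ∘ g S) := by
    ext i j
    simp
  have h2 : ∏ c ∈ S, w c = ∏ i, w (g S i) := by
    conv_lhs => rw [← himg S hS']
    exact Finset.prod_image fun i _ j _ h => hinj S hS' h
  rw [h1, Matrix.det_mul, Matrix.det_diagonal, h2, ← Matrix.transpose_submatrix,
    Matrix.det_transpose]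
  simp only [Function.comp_apply]
  ring

variable {X : Type*} [TopologicalSpace X] [T2Space X] {C : Set X} [CWComplex C]
  [∀ k, Fintype (RelCWComplex.cell C k)]

/-- As `E` is onto, both lattices are images under the injective `β`: one of all of `ℤ^ι`, the other
of the range of the square minor. The index is thus that of the minor's range. -/
theorem relIndex_boundaries (o : Orientation C) (T : CWComplex.Subcomplex C) (n : ℕ)
    {ι : Type*} [Fintype ι] [DecidableEq ι]
    (b : Module.Basis ι ℤ (boundaries o (whole C) ℤ n))
    (E : Matrix ι (RelCWComplex.cell C (n + 1)) ℤ) (F : Matrix (RelCWComplex.cell C (n + 1)) ι ℤ)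
    (hE : incidence o n = (Matrix.of fun j i => (b i : RelCWComplex.cell C n → ℤ) j) * E)
    (hF : E * F = 1) (g : ι → RelCWComplex.cell C (n + 1)) (hg : Function.Injective g)
    (hT : Set.range g = T.I (n + 1)) (hdet : (E.submatrix id g).det ≠ 0) :
    (boundaries o T ℤ n).toAddSubgroup.relIndex (boundaries o (whole C) ℤ n).toAddSubgroup =
      (E.submatrix id g).det.natAbs := by
  set β : Matrix (RelCWComplex.cell C n) ι ℤ :=
    Matrix.of fun j i => (b i : RelCWComplex.cell C n → ℤ) j with hβ
  have h1 : (boundaries o T ℤ n).toAddSubgroup =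
      (LinearMap.range (E.submatrix id g).mulVecLin).toAddSubgroup.map
        (β.mulVecLin : (ι → ℤ) →+ _) := by
    have : (incidence o n).submatrix id g = β * E.submatrix id g := by
      rw [hE]; rfl
    rw [boundaries_eq_range o T ℤ n g hg hT, map_intCast_int, this, Matrix.mulVecLin_mul,
      LinearMap.range_comp]
    rfl
  have h2 : (boundaries o (whole C) ℤ n).toAddSubgroup =
      (⊤ : AddSubgroup (ι → ℤ)).map (β.mulVecLin : (ι → ℤ) →+ _) := by
    have hsurj : LinearMap.range E.mulVecLin = ⊤ :=
      LinearMap.range_eq_top.2 fun v => ⟨F.mulVec v, by simp [hF]⟩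
    rw [boundaries_whole, boundary, map_intCast_int, hE, Matrix.mulVecLin_mul,
      LinearMap.range_comp, hsurj]
    rfl
  rw [h1, h2, AddSubgroup.relIndex_map_map_of_injective _ _ (injective_mulVec_basis _ b),
    AddSubgroup.relIndex_top_right]
  have hM : LinearMap.toMatrix (Pi.basisFun ℤ ι) (Pi.basisFun ℤ ι) (E.submatrix id g).mulVecLin =
      E.submatrix id g := by
    rw [LinearMap.toMatrix_eq_toMatrix']
    exact LinearMap.toMatrix'_toLin' _
  have := card_quotient_range_eq_natAbs_det (Pi.basisFun ℤ ι) (Pi.basisFun ℤ ι)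
    (E.submatrix id g).mulVecLin (by rwa [hM])
  rw [hM] at this
  exact this

/-- Both homology groups are quotients of the same cycles, by nested boundary lattices of finite
index. -/
theorem torsionOrder_homology (o : Orientation C) (T : CWComplex.Subcomplex C) {n : ℕ}
    (h : T.I n = Set.univ) (hfin : (boundaries o T ℤ n).toAddSubgroup.relIndex
      (boundaries o (whole C) ℤ n).toAddSubgroup ≠ 0) :
    torsionOrder (Homology o T ℤ n) = (boundaries o T ℤ n).toAddSubgroup.relIndex
      (boundaries o (whole C) ℤ n).toAddSubgroup * torsionOrder (Homology o (whole C) ℤ n) := by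
  have hr : ((boundaries o T ℤ n).submoduleOf (cycles o (whole C) ℤ n)).toAddSubgroup.relIndex
      ((boundaries o (whole C) ℤ n).submoduleOf (cycles o (whole C) ℤ n)).toAddSubgroup =
      (boundaries o T ℤ n).toAddSubgroup.relIndex (boundaries o (whole C) ℤ n).toAddSubgroup :=
    AddSubgroup.relIndex_addSubgroupOf (H := (boundaries o T ℤ n).toAddSubgroup)
      (K := (boundaries o (whole C) ℤ n).toAddSubgroup)
      (L := (cycles o (whole C) ℤ n).toAddSubgroup) (boundaries_whole_le_cycles o ℤ n)
  have hle : (boundaries o T ℤ n).submoduleOf (cycles o (whole C) ℤ n) ≤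
      (boundaries o (whole C) ℤ n).submoduleOf (cycles o (whole C) ℤ n) :=
    Submodule.comap_mono (boundaries_le_whole o T ℤ n)
  unfold Homology
  rw [cycles_eq_whole o T ℤ h, torsionOrder_quotient_eq_mul _ _ hle (by rwa [hr]), hr]

/-- The weight of a spanning tree in terms of a minor of the reduced boundary matrix. -/
theorem treeWeight_eq (o : Orientation C) (T : CWComplex.Subcomplex C) (n : ℕ)
    (W : RelCWComplex.cell C (n + 1) → ℝ) (h : T.I n = Set.univ)
    {ι : Type*} [Fintype ι] [DecidableEq ι] [DecidableEq (RelCWComplex.cell C (n + 1))]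
    (b : Module.Basis ι ℤ (boundaries o (whole C) ℤ n))
    (E : Matrix ι (RelCWComplex.cell C (n + 1)) ℤ) (F : Matrix (RelCWComplex.cell C (n + 1)) ι ℤ)
    (hE : incidence o n = (Matrix.of fun j i => (b i : RelCWComplex.cell C n → ℤ) j) * E)
    (hF : E * F = 1) (S : Finset (RelCWComplex.cell C (n + 1)))
    (g : ι → RelCWComplex.cell C (n + 1)) (hg : Function.Injective g)
    (hgS : Finset.univ.image g = S) (hT : (S : Set _) = T.I (n + 1))
    (hdet : (E.submatrix id g).det ≠ 0) :
    treeWeight o n W T = (torsionOrder (Homology o (whole C) ℤ n) : ℝ) ^ 2 *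
      (((E.submatrix id g).det : ℝ) ^ 2 * ∏ c ∈ S, Real.exp (-W c)) := by
  classical
  have hrange : Set.range g = T.I (n + 1) := by
    rw [← hT, ← Set.image_univ, ← Finset.coe_univ, ← Finset.coe_image, hgS]
  have hri := relIndex_boundaries o T n b E F hE hF g hg hrange hdet
  have hS : (Finset.univ.filter (· ∈ T.I (n + 1))) = S := by
    ext c
    simp [← hT]
  rw [treeWeight, torsionOrder_homology o T h (by rw [hri]; simpa using hdet), hri, hS]
  simp only [Real.exp_neg, Nat.cast_mul, mul_pow, Nat.cast_natAbs, Int.cast_abs, sq_abs]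
  ring

/-- This matches the integral rank with the real rank behind the Betti numbers: over `ℝ`, `E`
remains onto because `E F = 1`, and `β` remains injective. -/
theorem finrank_boundaries_real (o : Orientation C) (n : ℕ) {ι : Type*} [Fintype ι] [DecidableEq ι]
    (b : Module.Basis ι ℤ (boundaries o (whole C) ℤ n))
    (E : Matrix ι (RelCWComplex.cell C (n + 1)) ℤ) (F : Matrix (RelCWComplex.cell C (n + 1)) ι ℤ)
    (hE : incidence o n = (Matrix.of fun j i => (b i : RelCWComplex.cell C n → ℤ) j) * E)
    (hF : E * F = 1) :
    Module.finrank ℝ (boundaries o (whole C) ℝ n) = Fintype.card ι := by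
  have hFr : E.map (Int.castRingHom ℝ) * F.map (Int.castRingHom ℝ) = 1 := by
    rw [← Matrix.map_mul, hF, Matrix.map_one _ (map_zero _) (map_one _)]
  have hsurj : LinearMap.range (E.map (Int.castRingHom ℝ)).mulVecLin = ⊤ :=
    LinearMap.range_eq_top.2 fun v => ⟨(F.map (Int.castRingHom ℝ)).mulVec v, by
      rw [Matrix.mulVecLin_apply, Matrix.mulVec_mulVec, hFr, Matrix.one_mulVec]⟩
  rw [← finrank_range_of_injective _ (injective_mulVec_basis _ b), boundaries_whole, boundary, hE]
  change Module.finrank ℝ (LinearMap.range (Matrix.map _ (Int.castRingHom ℝ)).mulVecLin) = _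
  rw [Matrix.map_mul, Matrix.mulVecLin_mul, LinearMap.range_comp, hsurj, Submodule.map_top]
  rfl

/-! ### Real isomorphisms and their determinants -/

/-- In the base-changed bases, `p ⊗ ℝ` has the same matrix cast to `ℝ`, and an isomorphism has unit
determinant. -/
theorem det_toMatrix_ne_zero_of_isRealIsomorphism {ι M N : Type*} [Fintype ι] [DecidableEq ι]
    [AddCommGroup M] [AddCommGroup N] (b : Module.Basis ι ℤ M) (a : Module.Basis ι ℤ N)
    (p : M →ₗ[ℤ] N) (hp : IsRealIsomorphism p) : (LinearMap.toMatrix b a p).det ≠ 0 := by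
  have h := LinearMap.toMatrix_baseChange ℝ p b a
  have h2 := LinearEquiv.isUnit_det (LinearEquiv.ofBijective _ hp)
    (Algebra.TensorProduct.basis ℝ b) (Algebra.TensorProduct.basis ℝ a)
  have h3 : LinearMap.toMatrix (Algebra.TensorProduct.basis ℝ b)
      (Algebra.TensorProduct.basis ℝ a) (LinearEquiv.ofBijective _ hp).toLinearMap =
      (LinearMap.toMatrix b a p).map (algebraMap ℤ ℝ) := h
  rw [h3, ← RingHom.mapMatrix_apply, ← RingHom.map_det] at h2
  intro h0
  rw [h0, map_zero] at h2
  exact not_isUnit_zero h2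

theorem cokerTorsion_eq_natAbs_det {ι M N : Type*} [Fintype ι] [DecidableEq ι]
    [AddCommGroup M] [AddCommGroup N] (b : Module.Basis ι ℤ M) (a : Module.Basis ι ℤ N)
    (p : M →ₗ[ℤ] N) (hM : (LinearMap.toMatrix b a p).det ≠ 0) :
    cokerTorsion p = (LinearMap.toMatrix b a p).det.natAbs := by
  have h := card_quotient_range_eq_natAbs_det b a p hM
  have : Finite (N ⧸ LinearMap.range p) := Nat.finite_of_card_ne_zero (by rw [h]; simpa using hM)
  rw [cokerTorsion, torsionOrder_of_finite, h]

/-! ### Summation over spanning trees -/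

theorem exists_enumeration {ι κ : Type*} [Fintype ι] [DecidableEq κ] [Nonempty κ]
    (S : Finset κ) : ∃ g : ι → κ, S.card = Fintype.card ι →
      Function.Injective g ∧ Finset.univ.image g = S := by
  by_cases hS : S.card = Fintype.card ι
  · let e := Fintype.equivOfCardEq ((Fintype.card_coe S).trans hS)
    refine ⟨fun i => (e.symm i : κ), fun _ =>
      ⟨Subtype.val_injective.comp e.symm.injective, ?_⟩⟩
    ext c
    simp only [Finset.mem_image, Finset.mem_univ, true_and]
    exact ⟨fun ⟨i, hi⟩ => hi ▸ (e.symm i).2, fun hc => ⟨e ⟨c, hc⟩, by simp⟩⟩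
  · exact ⟨fun _ => Classical.arbitrary κ, fun h => absurd h hS⟩

/-- The total weight of the spanning trees as a weighted Gram determinant. -/
theorem finsum_treeWeight [CWComplex.Finite C] (o : Orientation C) (n : ℕ)
    (hdim : Nonempty (RelCWComplex.cell C (n + 1)))
    (hdim' : ∀ m, n + 1 < m → IsEmpty (RelCWComplex.cell C m))
    (W : RelCWComplex.cell C (n + 1) → ℝ) {ι : Type*} [Fintype ι] [DecidableEq ι]
    [DecidableEq (RelCWComplex.cell C (n + 1))]
    (b : Module.Basis ι ℤ (boundaries o (whole C) ℤ n))
    (E : Matrix ι (RelCWComplex.cell C (n + 1)) ℤ) (F : Matrix (RelCWComplex.cell C (n + 1)) ι ℤ)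
    (hE : incidence o n = (Matrix.of fun j i => (b i : RelCWComplex.cell C n → ℤ) j) * E)
    (hF : E * F = 1) :
    ∑ᶠ T : {T : CWComplex.Subcomplex C // IsSpanningTree o n T}, treeWeight o n W T =
      (torsionOrder (Homology o (whole C) ℤ n) : ℝ) ^ 2 *
        (E.map (Int.cast : ℤ → ℝ) * Matrix.diagonal (fun c => Real.exp (-W c)) *
          (E.map (Int.cast : ℤ → ℝ)).transpose).det := by
  classical
  choose g hg using exists_enumeration (ι := ι) (κ := RelCWComplex.cell C (n + 1))
  have hcardB : Fintype.card ι = Module.finrank ℝ (boundaries o (whole C) ℝ n) :=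
    (finrank_boundaries_real o n b E F hE hF).symm
  have hinjβ := injective_mulVec_basis _ b
  have hiff : ∀ S : Finset (RelCWComplex.cell C (n + 1)),
      Function.Injective ((incidence o n).submatrix id (g S)).mulVec ↔
        (E.submatrix id (g S)).det ≠ 0 := fun S => by
    rw [← injective_mul_mulVec_iff _ hinjβ, hE]
    rfl
  have htree : ∀ (T : CWComplex.Subcomplex C) (S : Finset (RelCWComplex.cell C (n + 1))),
      (CWComplex.skeleton C n : Set X) ⊆ T → (S : Set _) = T.I (n + 1) →
      (IsSpanningTree o n T ↔ S.card = Fintype.card ι ∧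
        (E.submatrix id (g S)).det ≠ 0) := by
    intro T S hskel hS
    constructor
    · intro h
      -- The enumeration `g S` is only meaningful once `S` has the right size, so the criterion is
      -- first applied to the inclusion of `S` to obtain its cardinality.
      have h1 := ((isSpanningTree_iff o T (hdim' _ (by omega)) hskel
        (Subtype.val : S → RelCWComplex.cell C (n + 1)) Subtype.val_injective
        (by simpa using hS)).1 h).2
      have hc : S.card = Fintype.card ι := by
        rw [hcardB, ← h1, Fintype.card_coe]
      refine ⟨hc, (hiff S).1 ((isSpanningTree_iff o T (hdim' _ (by omega)) hskel (g S) (hg S hc).1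
        ?_).1 h).1⟩
      rw [← hS, ← Set.image_univ, ← Finset.coe_univ, ← Finset.coe_image, (hg S hc).2]
    · rintro ⟨hc, hd⟩
      refine (isSpanningTree_iff o T (hdim' _ (by omega)) hskel (g S) (hg S hc).1 ?_).2
        ⟨(hiff S).2 hd, hcardB⟩
      rw [← hS, ← Set.image_univ, ← Finset.coe_univ, ← Finset.coe_image, (hg S hc).2]
  have hexp : (E.map (Int.cast : ℤ → ℝ) * Matrix.diagonal (fun c => Real.exp (-W c)) *
      (E.map (Int.cast : ℤ → ℝ)).transpose).det =
      ∑ S : Finset (RelCWComplex.cell C (n + 1)) with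
        S.card = Fintype.card ι,
        (((E.submatrix id (g S)).det : ℝ) ^ 2 * ∏ c ∈ S, Real.exp (-W c)) := by
    have h := det_mul_diagonal_mul_transpose (E.map (Int.cast : ℤ → ℝ))
      (fun c => Real.exp (-W c)) g (fun S hS => (hg S hS).1) (fun S hS => (hg S hS).2)
    rw [h]
    refine Finset.sum_congr rfl fun S _ => ?_
    rw [show ((E.submatrix id (g S)).det : ℝ) = _ from
      RingHom.map_det (Int.castRingHom ℝ) (E.submatrix id (g S))]
    rfl
  have hweight : ∀ (T : CWComplex.Subcomplex C) (S : Finset (RelCWComplex.cell C (n + 1))),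
      IsSpanningTree o n T → (S : Set _) = T.I (n + 1) →
      treeWeight o n W T = (torsionOrder (Homology o (whole C) ℤ n) : ℝ) ^ 2 *
        (((E.submatrix id (g S)).det : ℝ) ^ 2 * ∏ c ∈ S, Real.exp (-W c)) := by
    intro T S hT hS
    obtain ⟨hc, hd⟩ := (htree T S hT.skeleton_subset hS).1 hT
    exact treeWeight_eq o T n W (cells_eq_univ_of_skeleton_subset _ hT.skeleton_subset le_rfl)
      b E F hE hF S (g S) (hg S hc).1 (hg S hc).2 hS hd
  have : Fintype {T : CWComplex.Subcomplex C // IsSpanningTree o n T} := Fintype.ofFinite _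
  rw [finsum_eq_sum_of_fintype, hexp, Finset.mul_sum]
  -- Trees correspond to their sets of top cells. Sets with vanishing minor are not trees, and their
  -- terms are zero, so only nonzero terms need matching.
  refine Finset.sum_bij_ne_zero
    (fun T _ _ => (Finset.univ.filter (· ∈ T.1.I (n + 1)))) ?_ ?_ ?_ ?_
  · intro T _ _
    exact Finset.mem_filter.2 ⟨Finset.mem_univ _,
      ((htree T _ T.2.skeleton_subset (by simp)).1 T.2).1⟩
  · intro T _ _ T' _ _ h
    refine Subtype.ext (eq_of_top_cells_eq hdim' T.2.skeleton_subset T'.2.skeleton_subset ?_)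
    ext c
    simpa using Finset.ext_iff.1 h c
  · intro S hS hne
    obtain ⟨T, hT, hTS⟩ := exists_subcomplex_top_cells (C := C) n S
    have htr : IsSpanningTree o n T := by
      refine (htree T S hT hTS.symm).2 ⟨(Finset.mem_filter.1 hS).2, fun h0 => hne ?_⟩
      rw [h0]
      simp
    refine ⟨⟨T, htr⟩, Finset.mem_univ _, ?_, ?_⟩
    · rwa [hweight T S htr hTS.symm]
    · ext c
      simp [hTS]
  · intro T _ _
    exact hweight T _ T.2 (by simp)

end MatrixTree

open MatrixTree in
/-- The weighted matrix-tree theorem for the Laplacian compressed to a lattice `A`. -/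
theorem mainTheorem6 {X : Type*} [TopologicalSpace X] [T2Space X] (C : Set X)
    [Topology.CWComplex C] [Topology.CWComplex.Finite C]
    [∀ k, Fintype (Topology.RelCWComplex.cell C k)] (hconn : _root_.IsConnected C)
    (n : ℕ) (hdim : Nonempty (Topology.RelCWComplex.cell C (n + 1)))
    (hdim' : ∀ m, n + 1 < m → IsEmpty (Topology.RelCWComplex.cell C m))
    (o : MatrixTree.Orientation C) (W : Topology.RelCWComplex.cell C (n + 1) → ℝ)
    (A : Submodule ℤ (Topology.RelCWComplex.cell C n → ℤ))
    (p : MatrixTree.boundaries o (MatrixTree.whole C) ℤ n →ₗ[ℤ] A)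
    (hp : MatrixTree.IsRealIsomorphism p) (hpA : MatrixTree.IsInducedBy o n A p) :
    LinearMap.det (MatrixTree.compressedLaplacian o n W A) =
      MatrixTree.gramDet A * (MatrixTree.cokerTorsion p : ℝ) ^ 2 /
          (MatrixTree.torsionOrder (MatrixTree.Homology o (MatrixTree.whole C) ℤ n) : ℝ) ^ 2 *
        ∑ᶠ T : {T : Topology.CWComplex.Subcomplex C // MatrixTree.IsSpanningTree o n T},
          MatrixTree.treeWeight o n W T := by
  classical
  let a := Module.Free.chooseBasis ℤ A
  let b₀ := Module.Free.chooseBasis ℤ (boundaries o (whole C) ℤ n)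
  have hrank : Module.finrank ℤ (boundaries o (whole C) ℤ n) = Module.finrank ℤ A := by
    rw [← Module.finrank_baseChange (R := ℝ), (LinearEquiv.ofBijective _ hp).finrank_eq,
      Module.finrank_baseChange]
  have hcard : Fintype.card (Module.Free.ChooseBasisIndex ℤ (boundaries o (whole C) ℤ n)) =
      Fintype.card (Module.Free.ChooseBasisIndex ℤ A) := by
    rw [← Module.finrank_eq_card_basis b₀, ← Module.finrank_eq_card_basis a, hrank]
  -- A real isomorphism forces equal ranks; a common index type makes the matrix of `p` square.
  let b := b₀.reindex (Fintype.equivOfCardEq hcard)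
  have hBrange : boundaries o (whole C) ℤ n = LinearMap.range (incidence o n).mulVecLin := by
    rw [boundaries_whole, boundary, map_intCast_int]
  obtain ⟨E, F, hE, hF⟩ := exists_factorization _ _ hBrange b
  have hM := det_toMatrix_ne_zero_of_isRealIsomorphism b a p hp
  have hθ : (torsionOrder (Homology o (whole C) ℤ n) : ℝ) ≠ 0 := by
    exact_mod_cast torsionOrder_ne_zero _
  rw [finsum_treeWeight o n hdim hdim' W b E F hE hF,
    det_compressedLaplacian o n W A p hpA b a E hE, cokerTorsion_eq_natAbs_det b a p hM]
  -- `gramDet` is defined with this very basis `a`, so its independence of the basis is not needed.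
  have hgram : gramDet A =
      (Matrix.gram ℝ (fun i => toReal (a i : RelCWComplex.cell C n → ℤ))).det := rfl
  rw [hgram]
  simp only [Nat.cast_natAbs, Int.cast_abs, sq_abs]
  field_simp
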